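/- Let $p$ be a prime, $\mathbb{F}_q$ a finite field of characteristic $p$ and $E=\mathbb{F}_q(\!(\pi)\!)$. Let $(R,R^+)$ be an affinoid perfectoid $\mathbb{F}_q$-algebra: $R$ is a perfectoid $\mathbb{F}_q$-algebra (a complete separated uniform Tate ring having a pseudo-uniformizer $\varpi$ with $\varpi^p\mid p$ in $R^\circ$ and such that $x\mapsto x^p$ induces a bijection $R^\circ/\varpi\to R^\circ/\varpi^p$) and $R^+\subset R^\circ$ is open and integrally closed in $R$. Here $R^\circ$ is the set of power-bounded elements, $R^{\circ\circ}$ the set of topologically nilpotent elements, and the elements of $R^{\circ\circ}\cap R^\times$ are called pseudo-uniformizers. Fix a pseudo-uniformizer $\varpi_R$ and a power-multiplicative complete non-archimedean ring norm $\|\cdot\|$ on $R$ defining its topology, with $\|\varpi_R\|=1/p$ and $\|\varpi_R x\|=\|\varpi_R\|\,\|x\|$ for all $x\in R$. For a nonempty interval $I\subset\,]0,1[$ let $\mathcal{O}(\mathbb{D}^*_I)$ be the ring of functions on the annulus $\mathbb{D}^*_I=\{|\pi|\in I\}$ over $(R,R^+)$, that is, the ring of Laurent series $\sum_{n\in\mathbb{Z}}a_n\pi^n$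 with $a_n\in R$ and $\|a_n\|\rho^n\to 0$ as $n\to\pm\infty$ for every $\rho\in I$ (it does not depend on $R^+$); for $I=\,]0,1[$ this is the ring $\mathcal{O}(Y)$ of functions on the open punctured disc $Y=\mathbb{D}^*$, with Frobenius $\varphi(\sum a_n\pi^n)=\sum a_n^q\pi^n$. The ring $R$ is perfect, and for $\varepsilon\in R^{\circ\circ}\cap R^\times$ put $$t_\varepsilon=\sum_{n\in\mathbb{Z}}\varepsilon^{q^{-n}}\pi^n\in\mathcal{O}(Y)^{\varphi=\pi}.$$ **Proposition.** Let $I=[\rho_1,\rho_2]\subset\,]0,1[$ be a nonempty closed interval with $\rho_1,\rho_2\in p^{\mathbb{Q}}$. Then there exist $\varepsilon_1,\varepsilon_2\in R^{\circ\circ}\cap R^\times$ such that $$\mathcal{O}(\mathbb{D}^*_I)\,t_{\varepsilon_1}+\mathcal{O}(\mathbb{D}^*_I)\,t_{\varepsilon_2}=\mathcal{O}(\mathbb{D}^*_I).$$ In particular $$\operatorname{Spec}\mathcal{O}(\mathbb{D}^*_I)=\bigcup_{\varepsilon\in R^{\circ\circ}\cap R^\times}D(t_\varepsilon).$$ -/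

import Mathlib

open Filter Topology

set_option linter.unusedSectionVars false

namespace FarguesCurve

/-! ## Perfectoid rings -/

section Topological

variable {R : Type*} [CommRing R] [TopologicalSpace R]

/-- A subset `S` of a topological ring is bounded if for every neighbourhood `U` of `0` there is a
neighbourhood `V` of `0` with `V * S ⊆ U`. -/
def IsBoundedSet (S : Set R) : Prop :=
  ∀ U ∈ 𝓝 (0 : R), ∃ V ∈ 𝓝 (0 : R), ∀ v ∈ V, ∀ s ∈ S, v * s ∈ U

variable (R) in
/-- The set `R°` of power-bounded elements. -/
def powerBounded : Set R :=
  {x | IsBoundedSet (Set.range fun n : ℕ => x ^ n)}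

/-- Pseudo-uniformizers: the elements of `R°° ∩ Rˣ`, i.e. the topologically nilpotent units. -/
def IsPseudoUniformizer (x : R) : Prop :=
  IsTopologicallyNilpotent x ∧ IsUnit x

variable (R) in
/-- Huber rings: there is an open subring `R₀` whose topology is adic for a finitely generated
ideal of `R₀`. -/
def IsHuberRing : Prop :=
  ∃ R₀ : Subring R, IsOpen (R₀ : Set R) ∧ ∃ J : Ideal R₀, J.FG ∧ IsAdic J

/-- A ring of integral elements of `R`: an open and integrally closed subring of `R` contained in
`R°`; then `(R, R⁺)` is an affinoid (Huber) pair. -/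
structure IsRingOfIntegralElements (Rplus : Subring R) : Prop where
  isOpen : IsOpen (Rplus : Set R)
  isIntegrallyClosedIn : IsIntegrallyClosedIn Rplus R
  le_powerBounded : (Rplus : Set R) ⊆ powerBounded R

end Topological

/-- Perfectoid (Tate) rings, with no base field: complete separated uniform Tate rings `R` which
have a pseudo-uniformizer `ϖ` such that `ϖ ^ p ∣ p` in `R°` and such that the `p`-th power map
`R° / ϖ → R° / ϖ ^ p` is bijective. -/
structure IsPerfectoid (p : ℕ) (R : Type*) [CommRing R] [UniformSpace R] : Prop where
  complete : CompleteSpace R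
  separated : T2Space R
  huber : IsHuberRing R
  uniform : IsBoundedSet (powerBounded R)
  frobenius : ∃ ϖ : R, IsPseudoUniformizer ϖ ∧
    (∃ y ∈ powerBounded R, (p : R) = ϖ ^ p * y) ∧
    (∀ x ∈ powerBounded R, (∃ z ∈ powerBounded R, x ^ p = ϖ ^ p * z) →
      ∃ w ∈ powerBounded R, x = ϖ * w) ∧
    (∀ x ∈ powerBounded R, ∃ y ∈ powerBounded R, ∃ z ∈ powerBounded R, x = y ^ p + ϖ ^ p * z)

/-! ## Perfectoid rings of characteristic `p` are perfect -/

section Perfect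

variable {R : Type*} [NormedCommRing R]

theorem norm_le_one_pow (hpow : IsPowMul (norm : R → ℝ)) {x : R} (hx : ‖x‖ ≤ 1) (n : ℕ) :
    ‖x ^ n‖ ≤ 1 := by
  rcases Nat.eq_zero_or_pos n with rfl | hn
  · simpa using hpow.map_one_le_one
  · rw [hpow x hn]; exact pow_le_one₀ (norm_nonneg _) hx

theorem norm_lt_one_of_nilp (hpow : IsPowMul (norm : R → ℝ)) {x : R}
    (hx : IsTopologicallyNilpotent x) : ‖x‖ < 1 := by
  have h1 : Tendsto (fun n : ℕ => ‖x ^ n‖) atTop (𝓝 0) := by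
    simpa using (Filter.Tendsto.norm hx)
  obtain ⟨n, hn, hn1⟩ := ((h1.eventually (gt_mem_nhds one_pos)).and (eventually_ge_atTop 1)).exists
  rw [hpow x hn1] at hn
  by_contra h
  exact absurd hn (not_lt.mpr (one_le_pow₀ (not_lt.mp h)))

theorem mem_powerBounded_of_norm_le_one (hpow : IsPowMul (norm : R → ℝ)) {x : R}
    (hx : ‖x‖ ≤ 1) : x ∈ powerBounded R := by
  intro U hU
  obtain ⟨r, hr, hrU⟩ := Metric.mem_nhds_iff.mp hU
  refine ⟨Metric.ball 0 r, Metric.ball_mem_nhds _ hr, ?_⟩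
  rintro v hv _ ⟨n, rfl⟩
  apply hrU
  rw [mem_ball_zero_iff] at hv ⊢
  calc ‖v * x ^ n‖ ≤ ‖v‖ * ‖x ^ n‖ := norm_mul_le _ _
    _ ≤ ‖v‖ * 1 := by gcongr; exact norm_le_one_pow hpow hx n
    _ < r := by simpa using hv

theorem norm_le_one_of_mem_powerBounded (hpow : IsPowMul (norm : R → ℝ)) {ϖ : R}
    (hϖ : IsPseudoUniformizer ϖ) {x : R} (hx : x ∈ powerBounded R) : ‖x‖ ≤ 1 := by
  obtain ⟨V, hV, hVx⟩ := hx _ (Metric.ball_mem_nhds (0 : R) one_pos)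
  obtain ⟨m, hm⟩ := (hϖ.1.eventually hV).exists
  obtain ⟨u, hu⟩ := hϖ.2.pow m
  have hb : ∀ n : ℕ, ‖x ^ n‖ ≤ ‖(↑u⁻¹ : R)‖ := by
    intro n
    have h1 : ‖(ϖ ^ m) * x ^ n‖ < 1 := by
      simpa using hVx _ hm _ ⟨n, rfl⟩
    have h2 : x ^ n = ↑u⁻¹ * (ϖ ^ m * x ^ n) := by
      rw [← hu, Units.inv_mul_cancel_left]
    calc ‖x ^ n‖ = ‖↑u⁻¹ * (ϖ ^ m * x ^ n)‖ := by rw [← h2]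
      _ ≤ ‖(↑u⁻¹ : R)‖ * ‖ϖ ^ m * x ^ n‖ := norm_mul_le _ _
      _ ≤ ‖(↑u⁻¹ : R)‖ * 1 := by gcongr
      _ = _ := mul_one _
  by_contra h
  obtain ⟨n, hn⟩ := pow_unbounded_of_one_lt (max ‖(↑u⁻¹ : R)‖ 1) (not_le.mp h)
  have hn1 : 1 ≤ n := by
    rcases Nat.eq_zero_or_pos n with rfl | h0
    · exact absurd hn (by simp)
    · exact h0
  have := hb n
  rw [hpow x hn1] at this
  exact absurd hn (not_lt.mpr (this.trans (le_max_left _ _)))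

theorem exists_pth_root (p : ℕ) [Fact p.Prime] [CompleteSpace R] [CharP R p]
    [IsUltrametricDist R] (hpow : IsPowMul (norm : R → ℝ)) (hR : IsPerfectoid p R) (x : R) :
    ∃ y : R, y ^ p = x := by
  obtain ⟨ϖ, hϖ, -, -, hsurj⟩ := hR.frobenius
  have hp : 0 < p := (Fact.out : p.Prime).pos
  have hlt := norm_lt_one_of_nilp hpow hϖ.1
  have key : ∀ x : R, ‖x‖ ≤ 1 → ∃ y : R, y ^ p = x := by
    intro x hx
    have hs : ∀ z : R, ∃ y w : R, ‖z‖ ≤ 1 → ‖y‖ ≤ 1 ∧ ‖w‖ ≤ 1 ∧ z = y ^ p + ϖ ^ p * w := by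
      intro z
      by_cases hz : ‖z‖ ≤ 1
      · obtain ⟨y, hy, w, hw, h⟩ := hsurj z (mem_powerBounded_of_norm_le_one hpow hz)
        exact ⟨y, w, fun _ => ⟨norm_le_one_of_mem_powerBounded hpow hϖ hy,
          norm_le_one_of_mem_powerBounded hpow hϖ hw, h⟩⟩
      · exact ⟨0, 0, fun h => absurd h hz⟩
    choose Y W hYW using hs
    let z : ℕ → R := fun n => W^[n] x
    have hz0 : z 0 = x := rfl
    have hzs : ∀ n, z (n + 1) = W (z n) := fun n => Function.iterate_succ_apply' W n x
    have hz : ∀ n, ‖z n‖ ≤ 1 := by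
      intro n
      induction n with
      | zero => exact hx
      | succ n ih => rw [hzs]; exact (hYW _ ih).2.1
    let s : ℕ → R := fun n => ∑ i ∈ Finset.range n, ϖ ^ i * Y (z i)
    have hsx : ∀ n, x = s n ^ p + (ϖ ^ p) ^ n * z n := by
      intro n
      induction n with
      | zero => simp [s, hz0, hp.ne']
      | succ n ih =>
        have h1 : s (n + 1) = s n + ϖ ^ n * Y (z n) := Finset.sum_range_succ _ _
        rw [h1, add_pow_char, hzs]
        conv_lhs => rw [ih]
        conv_lhs => rw [(hYW _ (hz n)).2.2]
        ring
    have hnorm : ∀ n, ‖ϖ ^ n‖ ≤ ‖ϖ‖ ^ n := by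
      intro n
      rcases Nat.eq_zero_or_pos n with rfl | hn
      · simpa using hpow.map_one_le_one
      · exact (hpow _ hn).le
    have hsum : Summable fun i : ℕ => ϖ ^ i * Y (z i) := by
      refine Summable.of_norm_bounded (summable_geometric_of_lt_one (norm_nonneg ϖ) hlt) ?_
      intro i
      calc ‖ϖ ^ i * Y (z i)‖ ≤ ‖ϖ ^ i‖ * ‖Y (z i)‖ := norm_mul_le _ _
        _ ≤ ‖ϖ‖ ^ i * 1 := by
          gcongr
          · exact hnorm i
          · exact (hYW _ (hz i)).1
        _ = _ := mul_one _
    obtain ⟨y, hy⟩ := hsum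
    refine ⟨y, ?_⟩
    have h1 : Tendsto (fun n => s n ^ p) atTop (𝓝 (y ^ p)) := hy.tendsto_sum_nat.pow p
    have h2 : Tendsto (fun n => (ϖ ^ p) ^ n * z n) atTop (𝓝 0) := by
      rw [tendsto_zero_iff_norm_tendsto_zero]
      have hlt' : ‖ϖ‖ ^ p < 1 := pow_lt_one₀ (norm_nonneg _) hlt hp.ne'
      refine squeeze_zero (fun _ => norm_nonneg _) (fun n => ?_)
        (tendsto_pow_atTop_nhds_zero_of_lt_one (by positivity) hlt')
      calc ‖(ϖ ^ p) ^ n * z n‖ ≤ ‖(ϖ ^ p) ^ n‖ * ‖z n‖ := norm_mul_le _ _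
        _ ≤ (‖ϖ‖ ^ p) ^ n * 1 := by
          gcongr
          · rw [← pow_mul, ← pow_mul]; exact hnorm _
          · exact hz n
        _ = _ := mul_one _
    have h3 : Tendsto (fun _ : ℕ => x) atTop (𝓝 (y ^ p + 0)) :=
      (h1.add h2).congr fun n => (hsx n).symm
    simpa using (tendsto_nhds_unique h3 tendsto_const_nhds)
  obtain ⟨n, hn⟩ : ∃ n : ℕ, ‖(ϖ ^ n) ^ p * x‖ ≤ 1 := by
    have : Tendsto (fun n : ℕ => (ϖ ^ n) ^ p * x) atTop (𝓝 (0 ^ p * x)) :=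
      (Filter.Tendsto.pow hϖ.1 p).mul_const x
    rw [zero_pow hp.ne', zero_mul] at this
    have := this.norm
    rw [norm_zero] at this
    exact (this.eventually (ge_mem_nhds one_pos)).exists
  obtain ⟨y, hy⟩ := key _ hn
  obtain ⟨u, hu⟩ := hϖ.2.pow n
  refine ⟨↑u⁻¹ * y, ?_⟩
  rw [mul_pow, hy, ← hu, ← mul_assoc, ← mul_pow, Units.inv_mul, one_pow, one_mul]

/-- The `q`-Frobenius of a perfectoid `𝔽_q`-algebra is bijective. -/
theorem bijective_frobenius (p : ℕ) [Fact p.Prime] (k : Type*) [Field k] [Fintype k] [CharP k p]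
    [Algebra k R] [CompleteSpace R] [IsUltrametricDist R] (hpow : IsPowMul (norm : R → ℝ))
    (hR : IsPerfectoid p R) : Function.Bijective (FiniteField.frobeniusAlgHom k R) := by
  constructor
  · rw [injective_iff_map_eq_zero]
    intro x hx
    have h1 : x ^ Fintype.card k = 0 := hx
    have h2 := hpow x (n := Fintype.card k) Fintype.card_pos
    rw [h1, norm_zero] at h2
    exact norm_eq_zero.mp (pow_eq_zero_iff Fintype.card_ne_zero |>.mp h2.symm)
  · rcases subsingleton_or_nontrivial R with h | h
    · exact fun x => ⟨x, Subsingleton.elim _ _⟩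
    · have : CharP R p := charP_of_injective_algebraMap (algebraMap k R).injective p
      obtain ⟨f, -, hf⟩ := FiniteField.card k p
      have hroot : ∀ n : ℕ, ∀ x : R, ∃ y : R, y ^ p ^ n = x := by
        intro n
        induction n with
        | zero => exact fun x => ⟨x, by simp⟩
        | succ n ih =>
          intro x
          obtain ⟨y, hy⟩ := exists_pth_root p hpow hR x
          obtain ⟨w, hw⟩ := ih y
          exact ⟨w, by rw [pow_succ, pow_mul, hw, hy]⟩
      intro x
      obtain ⟨y, hy⟩ := hroot f x
      exact ⟨y, by rw [FiniteField.coe_frobeniusAlgHom]; simpa [hf] using hy⟩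

/-- The Frobenius automorphism `x ↦ x ^ q` of a perfectoid `𝔽_q`-algebra. -/
noncomputable def frobeniusEquiv (p : ℕ) [Fact p.Prime] (k : Type*) [Field k] [Fintype k]
    [CharP k p] [Algebra k R] [CompleteSpace R] [IsUltrametricDist R]
    (hpow : IsPowMul (norm : R → ℝ)) (hR : IsPerfectoid p R) : R ≃ₐ[k] R :=
  AlgEquiv.ofBijective (FiniteField.frobeniusAlgHom k R) (bijective_frobenius p k hpow hR)

end Perfect

/-! ## Functions on punctured discs and annuli -/

/-- Nonempty intervals `I ⊆ ]0,1[` of radii. -/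
structure RadiusInterval where
  carrier : Set ℝ
  ordConnected : carrier.OrdConnected
  nonempty : carrier.Nonempty
  subset_Ioo : carrier ⊆ Set.Ioo 0 1

/-- The interval `]0,1[`. -/
def RadiusInterval.full : RadiusInterval where
  carrier := Set.Ioo 0 1
  ordConnected := Set.ordConnected_Ioo
  nonempty := ⟨1 / 2, by norm_num⟩
  subset_Ioo := subset_rfl

theorem RadiusInterval.pos (I : RadiusInterval) {ρ : ℝ} (h : ρ ∈ I.carrier) : 0 < ρ :=
  (I.subset_Ioo h).1

/-- The ring `𝒪(𝔻*_I)` of functions on the annulus `𝔻*_I` over `R`: Laurent series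
`∑ aₙ πⁿ` (`n ∈ ℤ`) with `aₙ ∈ R` such that for all `ρ ∈ I` one has `‖aₙ‖ ρⁿ → 0` when `n → ±∞`.
For `I = ]0,1[` this is the ring `𝒪(Y)` of functions on the open punctured disc
`Y = 𝔻* = {0 < |π| < 1}`. -/
@[ext]
structure AnnulusFun (R : Type*) [NormedCommRing R] (I : RadiusInterval) where
  coeff : ℤ → R
  tendsto_zero : ∀ ρ ∈ I.carrier, Tendsto (fun n : ℤ => ‖coeff n‖ * ρ ^ n) cofinite (𝓝 0)

namespace AnnulusFun

variable {R : Type*} [NormedCommRing R] {I : RadiusInterval}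

section Convergence

theorem tendsto_pair {a b : ℤ → R} {ρ : ℝ}
    (ha : Tendsto (fun n : ℤ => ‖a n‖ * ρ ^ n) cofinite (𝓝 0))
    (hb : Tendsto (fun n : ℤ => ‖b n‖ * ρ ^ n) cofinite (𝓝 0)) :
    Tendsto (fun x : ℤ × ℤ => (‖a x.1‖ * ρ ^ x.1) * (‖b x.2‖ * ρ ^ x.2)) cofinite (𝓝 0) :=
  tendsto_mul_cofinite_nhds_zero ha hb

theorem norm_term_le {a b : ℤ → R} {ρ : ℝ} (hρ : 0 < ρ) (i n : ℤ) :
    ‖a i * b (n - i)‖ * ρ ^ n ≤ (‖a i‖ * ρ ^ i) * (‖b (n - i)‖ * ρ ^ (n - i)) := by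
  have h : ρ ^ n = ρ ^ i * ρ ^ (n - i) := by
    rw [← zpow_add₀ hρ.ne']; congr 1; ring
  calc ‖a i * b (n - i)‖ * ρ ^ n ≤ (‖a i‖ * ‖b (n - i)‖) * ρ ^ n := by
        gcongr; exact norm_mul_le _ _
    _ = _ := by rw [h]; ring

variable [IsUltrametricDist R] [CompleteSpace R]

theorem summable_conv {a b : ℤ → R} {ρ : ℝ} (hρ : 0 < ρ)
    (ha : Tendsto (fun n : ℤ => ‖a n‖ * ρ ^ n) cofinite (𝓝 0))
    (hb : Tendsto (fun n : ℤ => ‖b n‖ * ρ ^ n) cofinite (𝓝 0)) (n : ℤ) :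
    Summable fun i : ℤ => a i * b (n - i) := by
  apply NonarchimedeanAddGroup.summable_of_tendsto_cofinite_zero
  rw [tendsto_zero_iff_norm_tendsto_zero]
  have hinj : Function.Injective (fun i : ℤ => ((i, n - i) : ℤ × ℤ)) :=
    fun i j h => (Prod.ext_iff.mp h).1
  have h1 := ((tendsto_pair ha hb).comp hinj.tendsto_cofinite).const_mul ((ρ ^ n)⁻¹)
  rw [mul_zero] at h1
  refine squeeze_zero (fun _ => norm_nonneg _) (fun i => ?_) h1
  have hn : 0 < ρ ^ n := zpow_pos hρ n
  rw [inv_mul_eq_div, le_div_iff₀ hn]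
  exact norm_term_le hρ i n

theorem tendsto_conv {a b : ℤ → R} {ρ : ℝ} (hρ : 0 < ρ)
    (ha : Tendsto (fun n : ℤ => ‖a n‖ * ρ ^ n) cofinite (𝓝 0))
    (hb : Tendsto (fun n : ℤ => ‖b n‖ * ρ ^ n) cofinite (𝓝 0)) :
    Tendsto (fun n : ℤ => ‖∑' i, a i * b (n - i)‖ * ρ ^ n) cofinite (𝓝 0) := by
  rw [Metric.tendsto_nhds]
  intro δ hδ
  have h1 := (tendsto_pair ha hb).eventually (gt_mem_nhds (half_pos hδ))
  rw [eventually_cofinite] at h1 ⊢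
  refine (h1.image fun x : ℤ × ℤ => x.1 + x.2).subset ?_
  intro n hn
  by_contra hcon
  apply hn
  have hn0 : 0 < ρ ^ n := zpow_pos hρ n
  have h2 : ‖∑' i, a i * b (n - i)‖ ≤ (δ / 2) / ρ ^ n := by
    refine IsUltrametricDist.norm_tsum_le_of_forall_le_of_nonneg (by positivity) fun i => ?_
    rw [le_div_iff₀ hn0]
    refine (norm_term_le hρ i n).trans ?_
    by_contra h3
    exact hcon ⟨(i, n - i), fun h4 => h3 h4.le, by simp⟩
  rw [le_div_iff₀ hn0] at h2
  rw [Real.dist_eq, sub_zero, abs_of_nonneg (by positivity)]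
  linarith

theorem summable_conv₂ {a b c : ℤ → R} {ρ : ℝ} (hρ : 0 < ρ)
    (ha : Tendsto (fun n : ℤ => ‖a n‖ * ρ ^ n) cofinite (𝓝 0))
    (hb : Tendsto (fun n : ℤ => ‖b n‖ * ρ ^ n) cofinite (𝓝 0))
    (hc : Tendsto (fun n : ℤ => ‖c n‖ * ρ ^ n) cofinite (𝓝 0)) (n : ℤ) :
    Summable fun x : ℤ × ℤ => a x.2 * b (x.1 - x.2) * c (n - x.1) := by
  apply NonarchimedeanAddGroup.summable_of_tendsto_cofinite_zero
  rw [tendsto_zero_iff_norm_tendsto_zero]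
  have h0 := tendsto_mul_cofinite_nhds_zero (tendsto_pair ha hb) hc
  have hinj : Function.Injective
      (fun x : ℤ × ℤ => (((x.2, x.1 - x.2), n - x.1) : (ℤ × ℤ) × ℤ)) := by
    rintro ⟨x, y⟩ ⟨x', y'⟩ h
    simp only [Prod.mk.injEq] at h
    ext <;> simp <;> omega
  have h1 := (h0.comp hinj.tendsto_cofinite).const_mul ((ρ ^ n)⁻¹)
  rw [mul_zero] at h1
  refine squeeze_zero (fun _ => norm_nonneg _) (fun x => ?_) h1
  have hn : 0 < ρ ^ n := zpow_pos hρ n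
  rw [inv_mul_eq_div, le_div_iff₀ hn]
  have h : ρ ^ n = ρ ^ x.2 * ρ ^ (x.1 - x.2) * ρ ^ (n - x.1) := by
    rw [← zpow_add₀ hρ.ne', ← zpow_add₀ hρ.ne']; congr 1; ring
  calc ‖a x.2 * b (x.1 - x.2) * c (n - x.1)‖ * ρ ^ n
      ≤ (‖a x.2‖ * ‖b (x.1 - x.2)‖ * ‖c (n - x.1)‖) * ρ ^ n := by
        gcongr; exact norm_mul₃_le
    _ = _ := by rw [h]; simp only [Function.comp]; ring

end Convergence

instance : Zero (AnnulusFun R I) := ⟨⟨0, fun ρ _ => by simp⟩⟩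

/-- The constant function `1`. -/
instance : One (AnnulusFun R I) :=
  ⟨⟨Pi.single 0 1, fun ρ _ => tendsto_nhds_of_eventually_eq <| by
    rw [eventually_cofinite]
    refine (Set.finite_singleton (0 : ℤ)).subset fun n hn => ?_
    by_contra h
    apply hn
    have : n ≠ 0 := h
    simp [this]⟩⟩

instance [IsUltrametricDist R] : Add (AnnulusFun R I) :=
  ⟨fun f g => ⟨f.coeff + g.coeff, fun ρ hρ => by
    have hp := I.pos hρ
    have h := (f.tendsto_zero ρ hρ).add (g.tendsto_zero ρ hρ)
    rw [add_zero] at h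
    refine squeeze_zero (fun n => by positivity) (fun n => ?_) h
    rw [← add_mul]
    gcongr
    exact norm_add_le _ _⟩⟩

instance : Neg (AnnulusFun R I) :=
  ⟨fun f => ⟨-f.coeff, fun ρ hρ => by simpa using f.tendsto_zero ρ hρ⟩⟩

variable [IsUltrametricDist R]

/-- Multiplication of Laurent series: the `n`-th coefficient of `f * g` is `∑ᵢ fᵢ gₙ₋ᵢ`. -/
noncomputable instance [CompleteSpace R] : Mul (AnnulusFun R I) :=
  ⟨fun f g => ⟨fun n => ∑' i, f.coeff i * g.coeff (n - i), fun ρ hρ =>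
    tendsto_conv (I.pos hρ) (f.tendsto_zero ρ hρ) (g.tendsto_zero ρ hρ)⟩⟩

@[simp] theorem coeff_zero (n : ℤ) : (0 : AnnulusFun R I).coeff n = 0 := rfl
theorem coeff_one (n : ℤ) : (1 : AnnulusFun R I).coeff n = (Pi.single 0 1 : ℤ → R) n := rfl
@[simp] theorem coeff_add (f g : AnnulusFun R I) (n : ℤ) :
    (f + g).coeff n = f.coeff n + g.coeff n := rfl
@[simp] theorem coeff_neg (f : AnnulusFun R I) (n : ℤ) : (-f).coeff n = -f.coeff n := rfl

variable [CompleteSpace R]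

theorem coeff_mul (f g : AnnulusFun R I) (n : ℤ) :
    (f * g).coeff n = ∑' i, f.coeff i * g.coeff (n - i) := rfl

theorem summable_coeff_mul (f g : AnnulusFun R I) (n : ℤ) :
    Summable fun i => f.coeff i * g.coeff (n - i) := by
  obtain ⟨ρ, hρ⟩ := I.nonempty
  exact summable_conv (I.pos hρ) (f.tendsto_zero ρ hρ) (g.tendsto_zero ρ hρ) n

protected theorem mul_comm' (f g : AnnulusFun R I) : f * g = g * f := by
  ext n
  rw [coeff_mul, coeff_mul, ← (Equiv.subLeft n).tsum_eq]
  refine tsum_congr fun i => ?_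
  simp [mul_comm]

protected theorem mul_assoc' (f g h : AnnulusFun R I) : f * g * h = f * (g * h) := by
  ext n
  obtain ⟨ρ, hρ⟩ := I.nonempty
  have hs := summable_conv₂ (I.pos hρ) (f.tendsto_zero ρ hρ) (g.tendsto_zero ρ hρ)
    (h.tendsto_zero ρ hρ) n
  have h1 : (f * g * h).coeff n =
      ∑' m, ∑' i, f.coeff i * g.coeff (m - i) * h.coeff (n - m) := by
    rw [coeff_mul]
    refine tsum_congr fun m => ?_
    rw [coeff_mul, (summable_coeff_mul f g m).tsum_mul_right]
  have h2 : (f * (g * h)).coeff n =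
      ∑' i, ∑' m, f.coeff i * g.coeff (m - i) * h.coeff (n - m) := by
    rw [coeff_mul]
    refine tsum_congr fun i => ?_
    rw [coeff_mul, ← (summable_coeff_mul g h (n - i)).tsum_mul_left,
      ← (Equiv.subRight i).tsum_eq]
    refine tsum_congr fun m => ?_
    simp [mul_assoc]
  rw [h1, h2]
  exact Summable.tsum_comm (hs.prod_symm)

protected theorem one_mul' (f : AnnulusFun R I) : 1 * f = f := by
  ext n
  rw [coeff_mul, tsum_eq_single 0]
  · simp [coeff_one]
  · intro i hi
    simp [coeff_one, hi]

protected theorem left_distrib' (f g h : AnnulusFun R I) : f * (g + h) = f * g + f * h := by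
  ext n
  rw [coeff_add, coeff_mul, coeff_mul, coeff_mul,
    ← (summable_coeff_mul f g n).tsum_add (summable_coeff_mul f h n)]
  simp [mul_add]

noncomputable instance : CommRing (AnnulusFun R I) where
  add_assoc f g h := by ext n; simp [add_assoc]
  zero_add f := by ext n; simp
  add_zero f := by ext n; simp
  add_comm f g := by ext n; simp [add_comm]
  neg_add_cancel f := by ext n; simp
  nsmul := nsmulRec
  zsmul := zsmulRec
  mul_assoc := AnnulusFun.mul_assoc'
  mul_comm := AnnulusFun.mul_comm'
  one_mul := AnnulusFun.one_mul'
  mul_one f := by rw [AnnulusFun.mul_comm', AnnulusFun.one_mul']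
  left_distrib := AnnulusFun.left_distrib'
  right_distrib f g h := by
    rw [AnnulusFun.mul_comm', AnnulusFun.left_distrib', AnnulusFun.mul_comm' h,
      AnnulusFun.mul_comm' h]
  zero_mul f := by ext n; simp [coeff_mul]
  mul_zero f := by ext n; simp [coeff_mul]

/-- Restriction of functions from the punctured disc `Y` to the annulus `𝔻*_I`. -/
noncomputable def restrict (I : RadiusInterval) :
    AnnulusFun R RadiusInterval.full →+* AnnulusFun R I where
  toFun f := ⟨f.coeff, fun ρ hρ => f.tendsto_zero ρ (I.subset_Ioo hρ)⟩
  map_zero' := rfl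
  map_one' := rfl
  map_add' _ _ := rfl
  map_mul' _ _ := rfl

variable (R I) in
/-- The coordinate function `π`. -/
noncomputable def coordinate : AnnulusFun R I :=
  ⟨Pi.single 1 1, fun ρ _ => tendsto_nhds_of_eventually_eq <| by
    rw [eventually_cofinite]
    refine (Set.finite_singleton (1 : ℤ)).subset fun n hn => ?_
    by_contra h
    apply hn
    have : n ≠ 1 := h
    simp [this]⟩

theorem coeff_coordinate_mul (f : AnnulusFun R I) (n : ℤ) :
    (coordinate R I * f).coeff n = f.coeff (n - 1) := by
  rw [coeff_mul, tsum_eq_single 1]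
  · simp [coordinate]
  · intro i hi
    simp [coordinate, hi]

/-! ### The Frobenius of `𝒪(Y)` -/

section Frobenius

theorem tendsto_frobenius (q : ℕ) (hq : 0 < q) (f : AnnulusFun R RadiusInterval.full)
    (ρ : ℝ) (hρ : ρ ∈ RadiusInterval.full.carrier) :
    Tendsto (fun n : ℤ => ‖f.coeff n ^ q‖ * ρ ^ n) cofinite (𝓝 0) := by
  have h0 : 0 < ρ := hρ.1
  have hq' : (q : ℝ)⁻¹ ≠ 0 := by positivity
  have hσ : ρ ^ ((q : ℝ)⁻¹) ∈ RadiusInterval.full.carrier :=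
    ⟨Real.rpow_pos_of_pos h0 _, Real.rpow_lt_one h0.le hρ.2 (by positivity)⟩
  have hσq : (ρ ^ ((q : ℝ)⁻¹)) ^ q = ρ := Real.rpow_inv_natCast_pow h0.le hq.ne'
  have h := (f.tendsto_zero _ hσ).pow q
  rw [zero_pow hq.ne'] at h
  refine squeeze_zero (fun n => by positivity) (fun n => ?_) h
  rw [mul_pow, ← zpow_natCast, ← zpow_natCast, zpow_comm, zpow_natCast, zpow_natCast, hσq]
  gcongr
  exact norm_pow_le' _ hq

/-- The Frobenius `φ (∑ aₙ πⁿ) = ∑ aₙ ^ q πⁿ` of `𝒪(Y)`, induced by the one of `R`. -/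
noncomputable def frobenius (k : Type*) [Field k] [Fintype k] [Algebra k R] :
    AnnulusFun R RadiusInterval.full →+* AnnulusFun R RadiusInterval.full where
  toFun f := ⟨fun n => f.coeff n ^ Fintype.card k, tendsto_frobenius _ Fintype.card_pos f⟩
  map_zero' := by
    ext n
    exact map_zero (FiniteField.frobeniusAlgHom k R)
  map_one' := by
    ext n
    rcases eq_or_ne n 0 with rfl | hn
    · simp [coeff_one]
    · simp [coeff_one, hn]
  map_add' f g := by
    ext n
    exact map_add (FiniteField.frobeniusAlgHom k R) _ _
  map_mul' f g := by
    ext n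
    have hc : Continuous (FiniteField.frobeniusAlgHom k R) := by
      rw [FiniteField.coe_frobeniusAlgHom]
      exact continuous_pow _
    rw [coeff_mul]
    have := (summable_coeff_mul f g n).map_tsum (FiniteField.frobeniusAlgHom k R) hc
    rw [FiniteField.coe_frobeniusAlgHom] at this
    change (∑' i, f.coeff i * g.coeff (n - i)) ^ Fintype.card k = _
    refine this.trans ?_
    exact tsum_congr fun i => mul_pow _ _ _

end Frobenius

/-! ### The sections `t_ε` -/

section Section

variable (p : ℕ) [Fact p.Prime] (k : Type*) [Field k] [Fintype k] [CharP k p] [Algebra k R]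
  (hpow : IsPowMul (norm : R → ℝ)) (hR : IsPerfectoid p R)

theorem frobeniusEquiv_apply (x : R) :
    frobeniusEquiv p k hpow hR x = x ^ Fintype.card k := rfl

theorem frobeniusEquiv_pow_apply (m : ℕ) (x : R) :
    (frobeniusEquiv p k hpow hR ^ m) x = x ^ Fintype.card k ^ m := by
  induction m with
  | zero => simp
  | succ m ih =>
    rw [pow_succ', AlgEquiv.mul_apply, ih, frobeniusEquiv_apply, ← pow_mul, pow_succ]

theorem frobeniusEquiv_neg_pow (m : ℕ) (x : R) :
    ((frobeniusEquiv p k hpow hR ^ (-(m : ℤ))) x) ^ Fintype.card k ^ m = x := by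
  rw [← frobeniusEquiv_pow_apply p k hpow hR, ← AlgEquiv.mul_apply, ← zpow_natCast,
    ← zpow_add]
  simp

theorem tendsto_section {ε : R} (hε : IsTopologicallyNilpotent ε) (ρ : ℝ)
    (hρ : ρ ∈ Set.Ioo (0 : ℝ) 1) :
    Tendsto (fun n : ℤ => ‖(frobeniusEquiv p k hpow hR ^ (-n)) ε‖ * ρ ^ n) cofinite (𝓝 0) := by
  have hε1 := norm_lt_one_of_nilp hpow hε
  have hq1 : 1 < Fintype.card k := Fintype.one_lt_card
  obtain ⟨h0, h1⟩ := hρ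
  have htop : Tendsto (fun n : ℕ => ‖(frobeniusEquiv p k hpow hR ^ (-(n : ℤ))) ε‖ * ρ ^ (n : ℤ))
      atTop (𝓝 0) := by
    refine squeeze_zero (fun n => by positivity) (fun n => ?_)
      (tendsto_pow_atTop_nhds_zero_of_lt_one h0.le h1)
    rw [zpow_natCast]
    have hn : 1 ≤ Fintype.card k ^ n := Nat.one_le_pow _ _ Fintype.card_pos
    have h2 := hpow ((frobeniusEquiv p k hpow hR ^ (-(n : ℤ))) ε) hn
    rw [frobeniusEquiv_neg_pow] at h2
    have h3 : ‖(frobeniusEquiv p k hpow hR ^ (-(n : ℤ))) ε‖ ≤ 1 := by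
      by_contra h
      have := one_le_pow₀ (n := Fintype.card k ^ n) (not_le.mp h).le
      linarith
    exact mul_le_of_le_one_left (by positivity) h3
  have hbot : Tendsto (fun n : ℕ => ‖(frobeniusEquiv p k hpow hR ^ (n : ℤ)) ε‖ * ρ ^ (-(n : ℤ)))
      atTop (𝓝 0) := by
    obtain ⟨N, hN⟩ := exists_pow_lt_of_lt_one h0 hε1
    have hr : ‖ε‖ ^ N / ρ < 1 := (div_lt_one h0).mpr hN
    have hgrow : ∀ᶠ m : ℕ in atTop, N * m ≤ Fintype.card k ^ m := by
      have h2 := (tendsto_pow_const_div_const_pow_of_one_lt 1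
        (show (1 : ℝ) < Fintype.card k by exact_mod_cast hq1)).const_mul (N : ℝ)
      rw [mul_zero] at h2
      filter_upwards [h2.eventually (gt_mem_nhds one_pos)] with m hm
      have hc : (0 : ℝ) < (Fintype.card k : ℝ) ^ m := by positivity
      rw [pow_one, ← mul_div_assoc, div_lt_one hc] at hm
      exact_mod_cast hm.le
    refine squeeze_zero' (Eventually.of_forall fun n => by positivity) ?_
      (tendsto_pow_atTop_nhds_zero_of_lt_one (by positivity) hr)
    filter_upwards [hgrow] with m hm
    have hn : 1 ≤ Fintype.card k ^ m := Nat.one_le_pow _ _ Fintype.card_pos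
    rw [zpow_natCast, frobeniusEquiv_pow_apply, hpow ε hn, zpow_neg, zpow_natCast, div_pow,
      ← pow_mul, div_eq_mul_inv]
    gcongr ?_ * _
    exact pow_le_pow_of_le_one (norm_nonneg _) hε1.le hm
  have htoNat : Tendsto Int.toNat atTop atTop :=
    tendsto_atTop_atTop.mpr fun b => ⟨b, fun a ha => by omega⟩
  rw [Int.cofinite_eq]
  refine Tendsto.sup ?_ ?_
  · have : Tendsto (fun n : ℤ => (-n).toNat) atBot atTop :=
      htoNat.comp tendsto_neg_atBot_atTop
    refine (hbot.comp this).congr' ?_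
    filter_upwards [eventually_le_atBot 0] with n hn
    have h2 : (((-n).toNat : ℕ) : ℤ) = -n := Int.toNat_of_nonneg (by omega)
    simp only [Function.comp, h2, neg_neg]
  · refine (htop.comp htoNat).congr' ?_
    filter_upwards [eventually_ge_atTop 0] with n hn
    have h2 : ((n.toNat : ℕ) : ℤ) = n := Int.toNat_of_nonneg hn
    simp only [Function.comp, h2]

/-- The section `t_ε = ∑ ε^{q^{-n}} πⁿ` (`n ∈ ℤ`) of `𝒪(Y)`, for `ε ∈ R°°`. -/
noncomputable def tSection (ε : R) (hε : IsTopologicallyNilpotent ε) :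
    AnnulusFun R RadiusInterval.full where
  coeff n := (frobeniusEquiv p k hpow hR ^ (-n)) ε
  tendsto_zero := tendsto_section p k hpow hR hε

/-- `t_ε ∈ 𝒪(Y)^{φ = π}`. -/
theorem frobenius_tSection (ε : R) (hε : IsTopologicallyNilpotent ε) :
    frobenius k (tSection p k hpow hR ε hε) =
      coordinate R RadiusInterval.full * tSection p k hpow hR ε hε := by
  ext n
  rw [coeff_coordinate_mul]
  change ((frobeniusEquiv p k hpow hR ^ (-n)) ε) ^ Fintype.card k =
    (frobeniusEquiv p k hpow hR ^ (-(n - 1))) ε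
  rw [← frobeniusEquiv_apply p k hpow hR, ← AlgEquiv.mul_apply,
    show -(n - 1) = 1 + -n by ring, zpow_add, zpow_one]

end Section

end AnnulusFun

end FarguesCurve

open FarguesCurve

/-!
Let `q` be the cardinality of `k`. The proof takes `ε₁ = ϖ` and `ε₂ = ϖ ^ (q + 1)`, independently
of the annulus, and shows that the two sections have no common zero on any closed annulus.

Suppose that `t_{ε₁}` and `t_{ε₂}` generate a proper ideal `J` of `A = 𝒪(𝔻*_I)`. With the supremum
norm, `A` is an ultrametric Banach ring (`AnnulusFun.completeSpace`), so `1` is not in the closure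
of `J` and the quotient seminorm of `A ⧸ J` is nonzero. Smoothing it and then making the unit `π`
multiplicative gives a nonarchimedean seminorm `g` on `A`, bounded by the norm, which kills `J` and
satisfies `g (π * f) = g π * g f` (`exists_ringSeminorm_le_norm`). Full multiplicativity of `g`, as
for a point of the Berkovich spectrum, is not needed. Put `x = g π ∈ I`.

The seminorm `g` is bounded by the Gauss norm of radius `x`. The coefficients `eₙ` of `t_{ε₁}` and
`t_{ε₂}` are units with `‖eₙ‖ * ‖eₙ⁻¹‖ = 1`, hence `g (eₙ πⁿ) = ‖eₙ‖ xⁿ`. If exactly one term had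
the largest seminorm, then `g` would not vanish on the sum
(`AnnulusFun.exists_two_dominant_terms`). So for both sections the maximum is attained twice.
For `t_{ε₁}`, whose coefficients have norms `Eₙ` with `Eₙ₋₁ = Eₙ ^ q`, this forces
`x = Eₙ ^ (q - 1)` for some `n` (`exists_eq_pow_of_two_dominant_terms`). For `t_{ε₂}`, whose
coefficients have norms `Eₘ ^ (q + 1)`, it forces `x = (Eₘ ^ (q + 1)) ^ (q - 1)` for some `m`.
Then `Eₙ = Eₘ ^ (q + 1)`, which is strictly between `Eₘ₋₂ = Eₘ ^ (q ^ 2)` and `Eₘ₋₁ = Eₘ ^ q`; this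
is impossible since `E` is strictly increasing.
-/

namespace FarguesCurve

/-! ### Seminorms dominated by an ultrametric norm -/

theorem exists_forall_ge_of_tendsto_zero {ι : Type*} [Nonempty ι] {u : ι → ℝ} (h0 : ∀ i, 0 ≤ u i)
    (hu : Tendsto u cofinite (𝓝 0)) : ∃ i, ∀ j, u j ≤ u i := by
  by_cases h : ∃ i, 0 < u i
  · obtain ⟨i, hi⟩ := h
    have hfin : {j | ¬ u j < u i}.Finite :=
      eventually_cofinite.mp (hu.eventually (gt_mem_nhds hi))
    obtain ⟨m, -, hm⟩ := Set.exists_max_image _ u hfin ⟨i, lt_irrefl _⟩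
    refine ⟨m, fun j => ?_⟩
    by_cases hj : u j < u i
    · exact hj.le.trans (hm i (lt_irrefl _))
    · exact hm j hj
  · push Not at h
    exact ⟨Classical.arbitrary ι, fun j => (h j).trans (h0 _)⟩

theorem norm_quotient_add_le_max {A : Type*} [SeminormedCommRing A]
    [IsUltrametricDist A] (J : Ideal A) (x y : A ⧸ J) : ‖x + y‖ ≤ max ‖x‖ ‖y‖ := by
  refine le_of_forall_pos_le_add fun δ hδ => ?_
  obtain ⟨a, rfl, ha⟩ := Ideal.Quotient.norm_mk_lt x hδ
  obtain ⟨b, rfl, hb⟩ := Ideal.Quotient.norm_mk_lt y hδ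
  calc ‖Ideal.Quotient.mk J a + Ideal.Quotient.mk J b‖
      = ‖Ideal.Quotient.mk J (a + b)‖ := by rw [map_add]
    _ ≤ ‖a + b‖ := Ideal.Quotient.norm_mk_le J _
    _ ≤ max ‖a‖ ‖b‖ := IsUltrametricDist.norm_add_le_max a b
    _ ≤ max (‖Ideal.Quotient.mk J a‖ + δ) (‖Ideal.Quotient.mk J b‖ + δ) :=
        max_le_max ha.le hb.le
    _ = _ := max_add_add_right _ _ _

/-- A proper ideal `J` of an ultrametric Banach ring lies in the kernel of a bounded nonarchimedean
seminorm which is multiplicative with respect to a given unit `c`. This replaces a point of the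
Berkovich spectrum supported on `J`, for which every element would be multiplicative. -/
theorem exists_ringSeminorm_le_norm {A : Type*} [NormedCommRing A] [NormOneClass A]
    [CompleteSpace A] [IsUltrametricDist A] {J : Ideal A} (hJ : J ≠ ⊤) {c : A} (hc : IsUnit c) :
    ∃ g : RingSeminorm A, g 1 = 1 ∧ IsNonarchimedean g ∧ (∀ a, g a ≤ ‖a‖) ∧
      (∀ a ∈ J, g a = 0) ∧ ∀ a, g (c * a) = g c * g a := by
  let μ : RingSeminorm A :=
    { toFun := fun a => ‖Ideal.Quotient.mk J a‖
      map_zero' := by simp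
      add_le' := fun a b => by rw [map_add]; exact norm_add_le _ _
      neg' := fun a => by rw [map_neg, norm_neg]
      mul_le' := fun a b => by rw [map_mul]; exact norm_mul_le _ _ }
  have hμ (a : A) : μ a = ‖Ideal.Quotient.mk J a‖ := rfl
  have hμle (a : A) : μ a ≤ ‖a‖ := Ideal.Quotient.norm_mk_le J a
  have hμna : IsNonarchimedean μ := fun a b => by
    simp only [hμ, map_add]
    exact norm_quotient_add_le_max J _ _
  have hμ1 : μ 1 ≤ 1 := (hμle 1).trans_eq norm_one
  -- A proper ideal of a Banach ring is not dense, so `1` stays nonzero in the quotient.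
  have hμ1ne : μ 1 ≠ 0 := fun h => by
    have h2 : (1 : A) ∈ closure (J : Set A) :=
      (QuotientAddGroup.norm_mk_eq_zero_iff_mem_closure (S := J.toAddSubgroup)).mp h
    exact J.closure_ne_top hJ ((Ideal.eq_top_iff_one _).mpr h2)
  have hμ1eq : μ 1 = 1 := by
    refine le_antisymm hμ1 ?_
    have h1 := map_mul_le_mul μ 1 1
    rw [mul_one] at h1
    have h2 : 0 < μ 1 := (apply_nonneg μ 1).lt_of_ne' hμ1ne
    nlinarith
  let f := smoothingSeminorm μ hμ1 hμna
  have hfμ (a : A) : f a ≤ μ a := smoothingFun_le_self μ a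
  have hfpm : IsPowMul f := isPowMul_smoothingFun μ hμ1
  have hf1 : f 1 = 1 := by
    refine Eq.trans (smoothingFun_of_powMul μ hμ1 fun n _ => ?_) hμ1eq
    rw [one_pow, hμ1eq, one_pow]
  have hfc : f c ≠ 0 := fun h => by
    obtain ⟨d, hd⟩ := hc.exists_right_inv
    have := map_mul_le_mul f c d
    rw [hd, hf1, h, zero_mul] at this
    linarith
  have hle (a : A) : seminormFromConst hf1.le hfc hfpm a ≤ μ a :=
    (seminormFromConst_le_seminorm hf1.le hfc hfpm a).trans (hfμ a)
  refine ⟨seminormFromConst hf1.le hfc hfpm, seminormFromConst_one hf1.le hfc hfpm,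
    seminormFromConst_isNonarchimedean hf1.le hfc hfpm
      (isNonarchimedean_smoothingFun μ hμ1 hμna),
    fun a => (hle a).trans (hμle a), fun a ha => ?_,
    fun a => seminormFromConst_const_mul hf1.le hfc hfpm a⟩
  refine le_antisymm ((hle a).trans_eq ?_) (apply_nonneg _ a)
  rw [hμ, Ideal.Quotient.eq_zero_iff_mem.mpr ha, norm_zero]

/-! ### The Banach ring of functions on a closed annulus -/

/-- The supremum of `ρ ↦ ρ ^ n` on the interval `[ρ₁, ρ₂]` of positive reals; it is attained at an
end point since `ρ ^ n` is monotone or antitone. -/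
noncomputable def annulusWeight (ρ₁ ρ₂ : ℝ) (n : ℤ) : ℝ := max (ρ₁ ^ n) (ρ₂ ^ n)

section Weight

variable {ρ₁ ρ₂ : ℝ}

theorem annulusWeight_pos (h₁ : 0 < ρ₁) (n : ℤ) : 0 < annulusWeight ρ₁ ρ₂ n :=
  lt_max_of_lt_left (zpow_pos h₁ n)

theorem annulusWeight_add_le (h₁ : 0 < ρ₁) (h₁₂ : ρ₁ ≤ ρ₂) (m n : ℤ) :
    annulusWeight ρ₁ ρ₂ (m + n) ≤ annulusWeight ρ₁ ρ₂ m * annulusWeight ρ₁ ρ₂ n := by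
  have h₂ := h₁.trans_le h₁₂
  have hm := (annulusWeight_pos (ρ₂ := ρ₂) h₁ m).le
  refine max_le ?_ ?_
  · rw [zpow_add₀ h₁.ne']
    exact mul_le_mul (le_max_left _ _) (le_max_left _ _) (by positivity) hm
  · rw [zpow_add₀ h₂.ne']
    exact mul_le_mul (le_max_right _ _) (le_max_right _ _) (by positivity) hm

theorem zpow_le_annulusWeight (h₁ : 0 < ρ₁) {ρ : ℝ} (hρ : ρ ∈ Set.Icc ρ₁ ρ₂) (n : ℤ) :
    ρ ^ n ≤ annulusWeight ρ₁ ρ₂ n := by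
  have h0 := h₁.trans_le hρ.1
  rcases le_total 0 n with hn | hn
  · exact (zpow_le_zpow_left₀ hn h0.le hρ.2).trans (le_max_right _ _)
  · refine le_trans ?_ (le_max_left _ _)
    have h := zpow_le_zpow_left₀ (neg_nonneg.mpr hn) h₁.le hρ.1
    rw [zpow_neg, zpow_neg] at h
    exact (inv_le_inv₀ (zpow_pos h₁ n) (zpow_pos h0 n)).mp h

end Weight

namespace AnnulusFun

variable {R : Type*} [NormedCommRing R] {I : RadiusInterval} {ρ₁ ρ₂ : ℝ}

theorem tendsto_norm_mul_annulusWeight (hI : I.carrier = Set.Icc ρ₁ ρ₂) (f : AnnulusFun R I) :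
    Tendsto (fun n => ‖f.coeff n‖ * annulusWeight ρ₁ ρ₂ n) cofinite (𝓝 0) := by
  have h₁₂ : ρ₁ ≤ ρ₂ := Set.nonempty_Icc.mp (hI ▸ I.nonempty)
  have h1 := f.tendsto_zero ρ₁ (hI ▸ Set.left_mem_Icc.mpr h₁₂)
  have h2 := f.tendsto_zero ρ₂ (hI ▸ Set.right_mem_Icc.mpr h₁₂)
  have h := h1.max h2
  rw [max_self] at h
  exact h.congr fun n => (mul_max_of_nonneg _ _ (norm_nonneg _)).symm

variable [IsUltrametricDist R] [CompleteSpace R]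

/-- The supremum norm of a function on the closed annulus `ρ₁ ≤ |π| ≤ ρ₂`. -/
noncomputable def supNorm (ρ₁ ρ₂ : ℝ) (f : AnnulusFun R I) : ℝ :=
  ⨆ n, ‖f.coeff n‖ * annulusWeight ρ₁ ρ₂ n

theorem radius_pos (hI : I.carrier = Set.Icc ρ₁ ρ₂) : 0 < ρ₁ :=
  I.pos (hI ▸ Set.left_mem_Icc.mpr (Set.nonempty_Icc.mp (hI ▸ I.nonempty)))

theorem radius_le (hI : I.carrier = Set.Icc ρ₁ ρ₂) : ρ₁ ≤ ρ₂ :=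
  Set.nonempty_Icc.mp (hI ▸ I.nonempty)

theorem le_supNorm (hI : I.carrier = Set.Icc ρ₁ ρ₂) (f : AnnulusFun R I) (n : ℤ) :
    ‖f.coeff n‖ * annulusWeight ρ₁ ρ₂ n ≤ supNorm ρ₁ ρ₂ f := by
  refine le_ciSup (f := fun n => ‖f.coeff n‖ * annulusWeight ρ₁ ρ₂ n) ?_ n
  obtain ⟨m, hm⟩ := exists_forall_ge_of_tendsto_zero
    (fun n => mul_nonneg (norm_nonneg _) (annulusWeight_pos (radius_pos hI) n).le)
    (tendsto_norm_mul_annulusWeight hI f)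
  exact ⟨_, by rintro _ ⟨n, rfl⟩; exact hm n⟩

theorem supNorm_le {f : AnnulusFun R I} {δ : ℝ}
    (h : ∀ n, ‖f.coeff n‖ * annulusWeight ρ₁ ρ₂ n ≤ δ) : supNorm ρ₁ ρ₂ f ≤ δ :=
  ciSup_le h

theorem supNorm_nonneg (hI : I.carrier = Set.Icc ρ₁ ρ₂) (f : AnnulusFun R I) :
    0 ≤ supNorm ρ₁ ρ₂ f :=
  (mul_nonneg (norm_nonneg _) (annulusWeight_pos (radius_pos hI) 0).le).trans (le_supNorm hI f 0)

theorem supNorm_add_le_max (hI : I.carrier = Set.Icc ρ₁ ρ₂) (f g : AnnulusFun R I) :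
    supNorm ρ₁ ρ₂ (f + g) ≤ max (supNorm ρ₁ ρ₂ f) (supNorm ρ₁ ρ₂ g) := by
  refine supNorm_le fun n => ?_
  have hw := (annulusWeight_pos (ρ₂ := ρ₂) (radius_pos hI) n).le
  calc ‖(f + g).coeff n‖ * annulusWeight ρ₁ ρ₂ n
      ≤ max ‖f.coeff n‖ ‖g.coeff n‖ * annulusWeight ρ₁ ρ₂ n := by
        gcongr; exact IsUltrametricDist.norm_add_le_max _ _
    _ = max (‖f.coeff n‖ * annulusWeight ρ₁ ρ₂ n) (‖g.coeff n‖ * annulusWeight ρ₁ ρ₂ n) :=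
        max_mul_of_nonneg _ _ hw
    _ ≤ _ := max_le_max (le_supNorm hI f n) (le_supNorm hI g n)

theorem supNorm_mul_le (hI : I.carrier = Set.Icc ρ₁ ρ₂) (f g : AnnulusFun R I) :
    supNorm ρ₁ ρ₂ (f * g) ≤ supNorm ρ₁ ρ₂ f * supNorm ρ₁ ρ₂ g := by
  have h₁ := radius_pos hI
  refine supNorm_le fun n => ?_
  have hw := annulusWeight_pos (ρ₂ := ρ₂) h₁ n
  rw [← le_div_iff₀ hw, coeff_mul]
  refine IsUltrametricDist.norm_tsum_le_of_forall_le_of_nonneg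
    (div_nonneg (mul_nonneg (supNorm_nonneg hI f) (supNorm_nonneg hI g)) hw.le) fun i => ?_
  rw [le_div_iff₀ hw]
  have hadd := annulusWeight_add_le h₁ (radius_le hI) i (n - i)
  rw [add_sub_cancel] at hadd
  calc ‖f.coeff i * g.coeff (n - i)‖ * annulusWeight ρ₁ ρ₂ n
      ≤ (‖f.coeff i‖ * ‖g.coeff (n - i)‖) *
          (annulusWeight ρ₁ ρ₂ i * annulusWeight ρ₁ ρ₂ (n - i)) := by
        gcongr; exact norm_mul_le _ _
    _ = (‖f.coeff i‖ * annulusWeight ρ₁ ρ₂ i) *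
          (‖g.coeff (n - i)‖ * annulusWeight ρ₁ ρ₂ (n - i)) := by ring
    _ ≤ _ := mul_le_mul (le_supNorm hI f i) (le_supNorm hI g _)
        (mul_nonneg (norm_nonneg _) (annulusWeight_pos h₁ _).le) (supNorm_nonneg hI f)

/-- The supremum norm as a norm of additive groups. -/
noncomputable def supGroupNorm (hI : I.carrier = Set.Icc ρ₁ ρ₂) :
    AddGroupNorm (AnnulusFun R I) where
  toFun := supNorm ρ₁ ρ₂
  map_zero' := by simp [supNorm]
  add_le' f g := (supNorm_add_le_max hI f g).trans
    (max_le_add_of_nonneg (supNorm_nonneg hI f) (supNorm_nonneg hI g))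
  neg' f := by simp [supNorm]
  eq_zero_of_map_eq_zero' f hf := by
    ext n
    have h := (le_supNorm hI f n).trans_eq hf
    exact norm_le_zero_iff.mp (nonpos_of_mul_nonpos_left h (annulusWeight_pos (radius_pos hI) n))

/-- The ring of functions on a closed annulus, normed by the supremum norm. This is not an instance,
as it depends on the end points of `I`. -/
noncomputable abbrev normedCommRing (hI : I.carrier = Set.Icc ρ₁ ρ₂) :
    NormedCommRing (AnnulusFun R I) where
  __ := (supGroupNorm (R := R) hI).toNormedAddCommGroup
  __ := (inferInstance : CommRing (AnnulusFun R I))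
  norm_mul_le := supNorm_mul_le hI

theorem isUltrametricDist (hI : I.carrier = Set.Icc ρ₁ ρ₂) :
    letI := normedCommRing (R := R) hI
    IsUltrametricDist (AnnulusFun R I) := by
  let := normedCommRing (R := R) hI
  exact IsUltrametricDist.isUltrametricDist_of_forall_norm_add_le_max_norm
    (supNorm_add_le_max hI)

theorem completeSpace (hI : I.carrier = Set.Icc ρ₁ ρ₂) :
    letI := normedCommRing (R := R) hI
    CompleteSpace (AnnulusFun R I) := by
  let := normedCommRing (R := R) hI
  have h₁ := radius_pos hI
  refine Metric.complete_of_cauchySeq_tendsto fun u hu => ?_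
  have hu' : ∀ δ > 0, ∃ N, ∀ m ≥ N, ∀ n ≥ N, ∀ i,
      ‖(u m).coeff i - (u n).coeff i‖ * annulusWeight ρ₁ ρ₂ i < δ := by
    intro δ hδ
    obtain ⟨N, hN⟩ := Metric.cauchySeq_iff.mp hu δ hδ
    refine ⟨N, fun m hm n hn i => ?_⟩
    have h := hN m hm n hn
    rw [dist_eq_norm] at h
    refine lt_of_le_of_lt ?_ h
    have h2 := le_supNorm hI (u m - u n) i
    rwa [sub_eq_add_neg, coeff_add, coeff_neg, ← sub_eq_add_neg] at h2
  have hlim : ∀ i, ∃ b, Tendsto (fun n => (u n).coeff i) atTop (𝓝 b) := fun i => by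
    refine cauchySeq_tendsto_of_complete (Metric.cauchySeq_iff.mpr fun δ hδ => ?_)
    have hw := annulusWeight_pos (ρ₂ := ρ₂) h₁ i
    obtain ⟨N, hN⟩ := hu' (δ * annulusWeight ρ₁ ρ₂ i) (mul_pos hδ hw)
    exact ⟨N, fun m hm n hn => by
      rw [dist_eq_norm]; exact lt_of_mul_lt_mul_right (hN m hm n hn i) hw.le⟩
  choose b hb using hlim
  -- Passing to the limit coefficientwise gives convergence in the supremum norm.
  have hub : ∀ δ > 0, ∃ N, ∀ m ≥ N, ∀ i,
      ‖(u m).coeff i - b i‖ * annulusWeight ρ₁ ρ₂ i ≤ δ := by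
    intro δ hδ
    obtain ⟨N, hN⟩ := hu' δ hδ
    refine ⟨N, fun m hm i => ?_⟩
    refine le_of_tendsto (((hb i).const_sub _).norm.mul_const _) ?_
    filter_upwards [eventually_ge_atTop N] with n hn using (hN m hm n hn i).le
  have hbw : Tendsto (fun i => ‖b i‖ * annulusWeight ρ₁ ρ₂ i) cofinite (𝓝 0) := by
    rw [Metric.tendsto_nhds]
    intro δ hδ
    obtain ⟨N, hN⟩ := hub (δ / 2) (half_pos hδ)
    filter_upwards [(tendsto_norm_mul_annulusWeight hI (u N)).eventually
      (gt_mem_nhds (half_pos hδ))] with i hi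
    have hw := (annulusWeight_pos (ρ₂ := ρ₂) h₁ i).le
    rw [Real.dist_eq, sub_zero, abs_of_nonneg (mul_nonneg (norm_nonneg _) hw)]
    have h3 : ‖b i‖ ≤ ‖(u N).coeff i‖ + ‖(u N).coeff i - b i‖ := by
      simpa using norm_sub_le ((u N).coeff i) ((u N).coeff i - b i)
    have h4 := mul_le_mul_of_nonneg_right h3 hw
    have h5 := hN N le_rfl i
    rw [add_mul] at h4
    linarith
  let f : AnnulusFun R I := ⟨b, fun ρ hρ => squeeze_zero
    (fun i => mul_nonneg (norm_nonneg _) (zpow_pos (I.pos hρ) i).le)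
    (fun i => mul_le_mul_of_nonneg_left (zpow_le_annulusWeight h₁ (hI ▸ hρ) i) (norm_nonneg _))
    hbw⟩
  refine ⟨f, Metric.tendsto_atTop.mpr fun δ hδ => ?_⟩
  obtain ⟨N, hN⟩ := hub (δ / 2) (half_pos hδ)
  refine ⟨N, fun n hn => ?_⟩
  rw [dist_eq_norm]
  refine lt_of_le_of_lt ?_ (half_lt_self hδ)
  refine supNorm_le (f := u n - f) fun i => ?_
  rw [sub_eq_add_neg, coeff_add, coeff_neg, ← sub_eq_add_neg]
  exact hN n hn i

/-! ### Monomials and Gauss norms -/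

/-- The Laurent monomial `a πⁿ`. -/
noncomputable def single (n : ℤ) (a : R) : AnnulusFun R I :=
  ⟨Pi.single n a, fun ρ _ => tendsto_nhds_of_eventually_eq <| by
    filter_upwards [(Set.finite_singleton n).compl_mem_cofinite] with m hm
    have : m ≠ n := hm
    simp [this]⟩

theorem coeff_single (n : ℤ) (a : R) (m : ℤ) :
    (single n a : AnnulusFun R I).coeff m = if m = n then a else 0 :=
  Pi.single_apply n a m

theorem single_zero_one : (single 0 1 : AnnulusFun R I) = 1 := rfl

theorem single_mul_single (m n : ℤ) (a b : R) :
    (single m a * single n b : AnnulusFun R I) = single (m + n) (a * b) := by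
  ext i
  rw [coeff_mul, tsum_eq_single m]
  · simp only [coeff_single, if_true, mul_ite, mul_zero]
    congr 1
    exact propext ⟨fun h => by omega, fun h => by omega⟩
  · intro j hj
    simp [coeff_single, hj]

theorem supNorm_single_le (h₁ : 0 < ρ₁) (n : ℤ) (a : R) :
    supNorm ρ₁ ρ₂ (single n a : AnnulusFun R I) ≤ ‖a‖ * annulusWeight ρ₁ ρ₂ n := by
  refine supNorm_le fun m => ?_
  rw [coeff_single]
  split_ifs with h
  · rw [h]
  · simpa using mul_nonneg (norm_nonneg a) (annulusWeight_pos h₁ n).le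

theorem coeff_sum {ι : Type*} (s : Finset ι) (f : ι → AnnulusFun R I) (n : ℤ) :
    (∑ i ∈ s, f i).coeff n = ∑ i ∈ s, (f i).coeff n :=
  map_sum (⟨⟨fun f => f.coeff n, rfl⟩, fun _ _ => rfl⟩ : AnnulusFun R I →+ R) f s

section Seminorm

variable {g : RingSeminorm (AnnulusFun R I)}

/-- If `π` is multiplicative for `g`, then so is `πⁿ` for every `n : ℤ`, here on constants. -/
theorem map_single_eq_zpow_mul (hg1 : g 1 = 1)
    (hmul : ∀ f, g (single 1 1 * f) = g (single 1 1) * g f) (n : ℤ) (a : R) :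
    0 < g (single 1 1) ∧ g (single n a) = g (single 1 1) ^ n * g (single 0 a) := by
  have hpos : 0 < g (single 1 1) := by
    refine (apply_nonneg g _).lt_of_ne' fun h => ?_
    have h1 := hmul (single (-1) 1)
    rw [single_mul_single, h, zero_mul, mul_one, add_neg_cancel, single_zero_one, hg1] at h1
    exact one_ne_zero h1
  refine ⟨hpos, ?_⟩
  have hstep (n : ℤ) : g (single (n + 1) a) = g (single 1 1) * g (single n a) := by
    rw [← hmul, single_mul_single, one_mul, add_comm]
  induction n with
  | zero => simp
  | succ n ih => rw [hstep, ih, zpow_add_one₀ hpos.ne']; ring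
  | pred n ih =>
    have h := hstep (-n - 1)
    rw [sub_add_cancel, ih] at h
    rw [zpow_sub_one₀ hpos.ne', mul_right_comm, h, mul_comm, inv_mul_cancel_left₀ hpos.ne']

/-- A bounded seminorm for which the coordinate `π` is multiplicative is bounded by the Gauss norm
of radius `|π|`. -/
theorem map_le_of_forall_coeff_le (hI : I.carrier = Set.Icc ρ₁ ρ₂)
    (hna : IsNonarchimedean g) (hg1 : g 1 = 1) (hle : ∀ f, g f ≤ supNorm ρ₁ ρ₂ f)
    (hmul : ∀ f, g (single 1 1 * f) = g (single 1 1) * g f) {f : AnnulusFun R I} {δ : ℝ}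
    (hδ : 0 < δ) (h : ∀ n, ‖f.coeff n‖ * g (single 1 1) ^ n ≤ δ) : g f ≤ δ := by
  have h₁ := radius_pos hI
  have hfin : {n | ¬ ‖f.coeff n‖ * annulusWeight ρ₁ ρ₂ n < δ}.Finite :=
    eventually_cofinite.mp ((tendsto_norm_mul_annulusWeight hI f).eventually (gt_mem_nhds hδ))
  let s := hfin.toFinset
  let head : AnnulusFun R I := ∑ n ∈ s, single n (f.coeff n)
  have hhead : g head ≤ δ := by
    refine Finset.sum_induction _ (fun f => g f ≤ δ)
      (fun a b ha hb => (hna a b).trans (max_le ha hb)) ?_ fun n _ => ?_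
    · rw [map_zero]; exact hδ.le
    · obtain ⟨hpos, hn⟩ := map_single_eq_zpow_mul hg1 hmul n (f.coeff n)
      rw [hn, mul_comm]
      refine le_trans (mul_le_mul_of_nonneg_right ?_ (zpow_pos hpos n).le) (h n)
      refine (hle _).trans ((supNorm_single_le h₁ 0 _).trans_eq ?_)
      simp [annulusWeight]
  -- Outside the finite set `s` the terms are already small for the supremum norm.
  have htail : g (f + -head) ≤ δ := by
    refine (hle _).trans (supNorm_le fun n => ?_)
    have hc : (f + -head).coeff n = if n ∈ s then 0 else f.coeff n := by
      rw [coeff_add, coeff_neg, coeff_sum]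
      simp only [coeff_single, Finset.sum_ite_eq]
      split_ifs <;> simp
    rw [hc]
    split_ifs with hn
    · simpa using hδ.le
    · have : ¬ ¬ ‖f.coeff n‖ * annulusWeight ρ₁ ρ₂ n < δ := fun h' =>
        hn (hfin.mem_toFinset.mpr h')
      exact (not_not.mp this).le
  calc g f = g (head + (f + -head)) := by congr 1; ring
    _ ≤ δ := (hna _ _).trans (max_le hhead htail)

theorem map_coordinate_mem_Icc (hI : I.carrier = Set.Icc ρ₁ ρ₂) [NormOneClass R]
    (hg1 : g 1 = 1) (hle : ∀ f, g f ≤ supNorm ρ₁ ρ₂ f)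
    (hmul : ∀ f, g (single 1 1 * f) = g (single 1 1) * g f) :
    g (single 1 1) ∈ Set.Icc ρ₁ ρ₂ := by
  have h₁ := radius_pos hI
  have h₁₂ := radius_le hI
  constructor
  · obtain ⟨hpos, h1⟩ := map_single_eq_zpow_mul hg1 hmul (-1) (1 : R)
    rw [single_zero_one, hg1, mul_one, zpow_neg_one] at h1
    have h2 := (hle _).trans (supNorm_single_le h₁ (-1) (1 : R))
    rw [h1, norm_one, one_mul, annulusWeight, zpow_neg_one, zpow_neg_one,
      max_eq_left (inv_anti₀ h₁ h₁₂)] at h2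
    exact (inv_le_inv₀ hpos h₁).mp h2
  · have h2 := (hle _).trans (supNorm_single_le h₁ 1 (1 : R))
    rwa [norm_one, one_mul, annulusWeight, zpow_one, zpow_one, max_eq_right h₁₂] at h2

/-- If the seminorm of a Laurent series vanishes, then the Gauss norm of the series is reached by
at least two terms, provided that the coefficients have inverses of inverse norm. -/
theorem exists_two_dominant_terms (hI : I.carrier = Set.Icc ρ₁ ρ₂) [NormOneClass R]
    (hna : IsNonarchimedean g) (hg1 : g 1 = 1) (hle : ∀ f, g f ≤ supNorm ρ₁ ρ₂ f)
    (hmul : ∀ f, g (single 1 1 * f) = g (single 1 1) * g f) {f : AnnulusFun R I}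
    (hf : ∀ n, ∃ b, f.coeff n * b = 1 ∧ ‖f.coeff n‖ * ‖b‖ = 1) (hgf : g f = 0) :
    ∃ m n, m < n ∧
      (∀ i, ‖f.coeff i‖ * g (single 1 1) ^ i ≤ ‖f.coeff m‖ * g (single 1 1) ^ m) ∧
      ∀ i, ‖f.coeff i‖ * g (single 1 1) ^ i ≤ ‖f.coeff n‖ * g (single 1 1) ^ n := by
  have hx := map_coordinate_mem_Icc hI hg1 hle hmul
  have hT := f.tendsto_zero _ (hI ▸ hx)
  obtain ⟨hpos, -⟩ := map_single_eq_zpow_mul hg1 hmul 0 (1 : R)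
  set x := g (single 1 1) with hxdef
  obtain ⟨m, hm⟩ := exists_forall_ge_of_tendsto_zero
    (fun n => mul_nonneg (norm_nonneg _) (zpow_pos hpos n).le) hT
  suffices h : ∃ n, n ≠ m ∧ ‖f.coeff m‖ * x ^ m ≤ ‖f.coeff n‖ * x ^ n by
    obtain ⟨n, hne, hn⟩ := h
    have hn' := fun i => (hm i).trans hn
    rcases hne.lt_or_gt with h | h
    · exact ⟨n, m, h, hn', hm⟩
    · exact ⟨m, n, h, hm, hn'⟩
  by_contra! hcon
  have hcm : ‖f.coeff m‖ ≤ g (single 0 (f.coeff m)) := by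
    obtain ⟨b, hb, hb'⟩ := hf m
    have h1 := map_mul_le_mul g (single 0 (f.coeff m)) (single 0 b)
    rw [single_mul_single, hb, add_zero, single_zero_one, hg1] at h1
    have h2 : g (single 0 b) ≤ ‖b‖ :=
      (hle _).trans ((supNorm_single_le (radius_pos hI) 0 b).trans_eq (by simp [annulusWeight]))
    have h3 : 0 < ‖b‖ := (norm_nonneg b).lt_of_ne' fun h => by simp [h] at hb'
    have h4 := mul_le_mul_of_nonneg_left h2 (apply_nonneg g (single 0 (f.coeff m)))
    exact le_of_mul_le_mul_right (hb'.le.trans (h1.trans h4)) h3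
  have hdom : ‖f.coeff m‖ * x ^ m ≤ g (single m (f.coeff m)) := by
    rw [(map_single_eq_zpow_mul hg1 hmul m (f.coeff m)).2, mul_comm]
    exact mul_le_mul_of_nonneg_left hcm (zpow_pos hpos m).le
  let rest : AnnulusFun R I := f + -single m (f.coeff m)
  have hrest (n : ℤ) : rest.coeff n = if n = m then 0 else f.coeff n := by
    rw [coeff_add, coeff_neg, coeff_single]
    split_ifs with h <;> simp [h]
  obtain ⟨l, hl⟩ := exists_forall_ge_of_tendsto_zero
    (fun n => mul_nonneg (norm_nonneg _) (zpow_pos hpos n).le) (rest.tendsto_zero _ (hI ▸ hx))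
  have hmpos : 0 < ‖f.coeff m‖ * x ^ m := by
    obtain ⟨b, -, hb'⟩ := hf m
    refine mul_pos ((norm_nonneg _).lt_of_ne' fun h => ?_) (zpow_pos hpos m)
    simp [h] at hb'
  have hlt : ‖rest.coeff l‖ * x ^ l < ‖f.coeff m‖ * x ^ m := by
    rw [hrest]
    split_ifs with h
    · simpa using hmpos
    · exact hcon l h
  obtain ⟨δ, hδ, hδ'⟩ := exists_between hlt
  have hδ0 : 0 < δ := (mul_nonneg (norm_nonneg _) (zpow_pos hpos l).le).trans_lt hδ
  have hr : g rest ≤ δ := map_le_of_forall_coeff_le hI hna hg1 hle hmul hδ0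
    fun n => (hl n).trans hδ.le
  have hfin : g (single m (f.coeff m)) ≤ δ := by
    calc g (single m (f.coeff m)) = g (f + -rest) := by congr 1; simp [rest]
      _ ≤ max (g f) (g (-rest)) := hna _ _
      _ ≤ δ := by rw [hgf, map_neg_eq_map]; exact max_le hδ0.le hr
  linarith

end Seminorm

end AnnulusFun

/-! ### Critical radii -/

/-- If the terms `Eₙ xⁿ` of a sequence with `Eₙ₋₁ = Eₙ ^ q` attain their maximum twice, then `x` is
one of the critical radii `Eₘ ^ (q - 1)`, at which the terms of index `m - 1` and `m` agree. -/
theorem exists_eq_pow_of_two_dominant_terms {E : ℤ → ℝ} {q : ℕ} (hq : 2 ≤ q)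
    (h0 : ∀ n, 0 < E n) (hmono : StrictMono E) (hE : ∀ n, E (n - 1) = E n ^ q) {x : ℝ}
    (hx : 0 < x) {m n : ℤ} (hmn : m < n) (hm : ∀ i, E i * x ^ i ≤ E m * x ^ m)
    (hn : ∀ i, E i * x ^ i ≤ E n * x ^ n) : x = E n ^ (q - 1) := by
  have hpow (i : ℤ) : E (i - 1) = E i ^ (q - 1) * E i := by
    rw [hE, ← pow_succ, Nat.sub_add_cancel (by omega)]
  have h1 : x ≤ E (m + 1) ^ (q - 1) := by
    have h := hm (m + 1)
    have h2 := hpow (m + 1)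
    rw [add_sub_cancel_right] at h2
    rw [h2, zpow_add_one₀ hx.ne'] at h
    have h3 : 0 < E (m + 1) * x ^ m := mul_pos (h0 _) (zpow_pos hx m)
    refine le_of_mul_le_mul_right ?_ h3
    linarith
  have h2 : E n ^ (q - 1) ≤ x := by
    have h := hn (n - 1)
    have h4 : x ^ n = x ^ (n - 1) * x := by rw [← zpow_add_one₀ hx.ne', sub_add_cancel]
    rw [hpow, h4] at h
    have h3 : 0 < E n * x ^ (n - 1) := mul_pos (h0 _) (zpow_pos hx _)
    refine le_of_mul_le_mul_right ?_ h3
    linarith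
  have h3 : E n ≤ E (m + 1) := le_of_pow_le_pow_left₀ (by omega) (h0 _).le (h2.trans h1)
  have h4 : n = m + 1 := le_antisymm (hmono.le_iff_le.mp h3) hmn
  subst h4
  exact le_antisymm h1 h2

/-- The critical radii of the sequences `E` and `E ^ (q + 1)` are distinct: `Eₘ ^ (q + 1)` lies
strictly between `Eₘ₋₂ = Eₘ ^ (q ^ 2)` and `Eₘ₋₁ = Eₘ ^ q`. -/
theorem pow_sub_one_ne_pow_succ_pow {E : ℤ → ℝ} {q : ℕ} (hq : 2 ≤ q)
    (h0 : ∀ n, 0 < E n) (h1 : ∀ n, E n < 1) (hmono : StrictMono E)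
    (hE : ∀ n, E (n - 1) = E n ^ q) (m n : ℤ) :
    E n ^ (q - 1) ≠ (E m ^ (q + 1)) ^ (q - 1) := by
  intro h
  have h2 : E n = E m ^ (q + 1) :=
    (pow_left_inj₀ (h0 n).le (pow_pos (h0 m) _).le (by omega)).mp h
  have h3 : E n < E (m - 1) := by
    rw [h2, hE]
    exact pow_lt_pow_right_of_lt_one₀ (h0 m) (h1 m) (by omega)
  have h4 : E (m - 1 - 1) < E n := by
    rw [h2, hE, hE, ← pow_mul]
    exact pow_lt_pow_right_of_lt_one₀ (h0 m) (h1 m) (by nlinarith)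
  have h5 := hmono.lt_iff_lt.mp h3
  have h6 := hmono.lt_iff_lt.mp h4
  omega

/-! ### Zeros of the sections `t_ε` -/

namespace AnnulusFun

section Section

variable {R : Type*} [NormedCommRing R] [IsUltrametricDist R] [CompleteSpace R]
variable (p : ℕ) [Fact p.Prime] (k : Type*) [Field k] [Fintype k] [CharP k p] [Algebra k R]
  (hpow : IsPowMul (norm : R → ℝ)) (hR : IsPerfectoid p R)

theorem frobeniusEquiv_zpow_pred (n : ℤ) (x : R) :
    (frobeniusEquiv p k hpow hR ^ (-(n - 1))) x =
      ((frobeniusEquiv p k hpow hR ^ (-n)) x) ^ Fintype.card k := by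
  rw [← frobeniusEquiv_apply p k hpow hR, ← AlgEquiv.mul_apply,
    show -(n - 1) = 1 + -n by ring, zpow_add, zpow_one]

theorem norm_frobeniusEquiv_zpow_pred (n : ℤ) (x : R) :
    ‖(frobeniusEquiv p k hpow hR ^ (-(n - 1))) x‖ =
      ‖(frobeniusEquiv p k hpow hR ^ (-n)) x‖ ^ Fintype.card k := by
  rw [frobeniusEquiv_zpow_pred, hpow _ Fintype.card_pos]

/-- A property of real numbers `≥ 0` which holds for `y` if and only if it holds for `y ^ q` can
be checked at one term of a sequence with `Eₙ₋₁ = Eₙ ^ q`. -/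
theorem forall_of_pow_iff {P : ℝ → Prop} {E : ℤ → ℝ} {q : ℕ} (h0 : ∀ n, 0 ≤ E n)
    (hE : ∀ n, E (n - 1) = E n ^ q) (hP : ∀ y, 0 ≤ y → (P (y ^ q) ↔ P y)) (h : P (E 0)) (n : ℤ) :
    P (E n) := by
  induction n with
  | zero => exact h
  | succ n ih =>
    rw [← hP _ (h0 _), ← hE, add_sub_cancel_right]
    exact ih
  | pred n ih => rw [hE, hP _ (h0 _)]; exact ih

theorem norm_frobeniusEquiv_zpow_mul_inv {u v : R} (huv : ‖u‖ * ‖v‖ = 1) (n : ℤ) :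
    ‖(frobeniusEquiv p k hpow hR ^ (-n)) u‖ * ‖(frobeniusEquiv p k hpow hR ^ (-n)) v‖ = 1 :=
  forall_of_pow_iff (P := (· = 1)) (q := Fintype.card k)
    (E := fun n => ‖(frobeniusEquiv p k hpow hR ^ (-n)) u‖ *
      ‖(frobeniusEquiv p k hpow hR ^ (-n)) v‖)
    (fun n => by positivity)
    (fun n => by simp only [norm_frobeniusEquiv_zpow_pred, mul_pow])
    (fun y hy => pow_eq_one_iff_of_nonneg hy Fintype.card_ne_zero) (by simpa using huv) n

theorem norm_frobeniusEquiv_zpow_mem_Ioo {u : R} (hu : ‖u‖ ∈ Set.Ioo (0 : ℝ) 1) (n : ℤ) :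
    ‖(frobeniusEquiv p k hpow hR ^ (-n)) u‖ ∈ Set.Ioo (0 : ℝ) 1 :=
  forall_of_pow_iff (P := (· ∈ Set.Ioo (0 : ℝ) 1)) (q := Fintype.card k)
    (E := fun n => ‖(frobeniusEquiv p k hpow hR ^ (-n)) u‖)
    (fun n => norm_nonneg _) (norm_frobeniusEquiv_zpow_pred p k hpow hR · u)
    (fun y hy => by
      rw [Set.mem_Ioo, Set.mem_Ioo, pow_lt_one_iff_of_nonneg hy Fintype.card_ne_zero]
      exact and_congr_left fun _ =>
        ⟨fun h => hy.lt_of_ne' (by rintro rfl; simp at h), fun h => pow_pos h _⟩)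
    (by simpa using hu) n

theorem strictMono_norm_frobeniusEquiv_zpow {u : R} (hu : ‖u‖ ∈ Set.Ioo (0 : ℝ) 1) :
    StrictMono fun n : ℤ => ‖(frobeniusEquiv p k hpow hR ^ (-n)) u‖ := by
  refine strictMono_int_of_lt_succ fun n => ?_
  have h := norm_frobeniusEquiv_zpow_pred p k hpow hR (n + 1) u
  have h' := norm_frobeniusEquiv_zpow_mem_Ioo p k hpow hR hu (n + 1)
  rw [add_sub_cancel_right] at h
  rw [h]
  exact pow_lt_self_of_lt_one₀ h'.1 h'.2 Fintype.one_lt_card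

/-- The section `t_ε` can vanish only at the critical radii `‖ε ^ (q ^ (-n))‖ ^ (q - 1)`. -/
theorem exists_radius_eq_of_map_tSection_eq_zero [NormOneClass R] {I : RadiusInterval}
    {ρ₁ ρ₂ : ℝ} (hI : I.carrier = Set.Icc ρ₁ ρ₂) {g : RingSeminorm (AnnulusFun R I)}
    (hna : IsNonarchimedean g) (hg1 : g 1 = 1) (hle : ∀ f, g f ≤ supNorm ρ₁ ρ₂ f)
    (hmul : ∀ f, g (single 1 1 * f) = g (single 1 1) * g f)
    {ε v : R} (hε : IsTopologicallyNilpotent ε) (hεv : ε * v = 1) (hεv' : ‖ε‖ * ‖v‖ = 1)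
    (hg : g (restrict I (tSection p k hpow hR ε hε)) = 0) :
    ∃ n : ℤ, g (single 1 1) =
      ‖(frobeniusEquiv p k hpow hR ^ (-n)) ε‖ ^ (Fintype.card k - 1) := by
  have hε' : ‖ε‖ ∈ Set.Ioo (0 : ℝ) 1 :=
    ⟨(norm_nonneg ε).lt_of_ne' fun h => by simp [h] at hεv', norm_lt_one_of_nilp hpow hε⟩
  obtain ⟨m, n, hmn, hm, hn⟩ := exists_two_dominant_terms hI hna hg1 hle hmul
    (fun n => ⟨(frobeniusEquiv p k hpow hR ^ (-n)) v,
      by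
        change (frobeniusEquiv p k hpow hR ^ (-n)) ε * _ = 1
        rw [← map_mul, hεv, map_one],
      norm_frobeniusEquiv_zpow_mul_inv p k hpow hR hεv' n⟩) hg
  exact ⟨n, exists_eq_pow_of_two_dominant_terms Fintype.one_lt_card
    (fun n => (norm_frobeniusEquiv_zpow_mem_Ioo p k hpow hR hε' n).1)
    (strictMono_norm_frobeniusEquiv_zpow p k hpow hR hε')
    (norm_frobeniusEquiv_zpow_pred p k hpow hR · ε)
    (map_single_eq_zpow_mul hg1 hmul 0 (1 : R)).1 hmn hm hn⟩

/-- The sections `t_u` and `t_v` with `v = u ^ (q + 1)` have no common zero. -/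
theorem span_tSection_sup_span_tSection_pow [NormOneClass R] {I : RadiusInterval}
    {ρ₁ ρ₂ : ℝ} (hI : I.carrier = Set.Icc ρ₁ ρ₂) {u v : R} (huv : u * v = 1)
    (huv' : ‖u‖ * ‖v‖ = 1) (hu : IsTopologicallyNilpotent u)
    (hu' : IsTopologicallyNilpotent (u ^ (Fintype.card k + 1))) :
    Ideal.span {restrict I (tSection p k hpow hR u hu)} ⊔
      Ideal.span {restrict I (tSection p k hpow hR (u ^ (Fintype.card k + 1)) hu')} = ⊤ := by
  by_contra hJ
  set q := Fintype.card k with hqdef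
  let := normedCommRing (R := R) hI
  have := isUltrametricDist (R := R) hI
  have := completeSpace (R := R) hI
  have hnorm (f : AnnulusFun R I) : ‖f‖ = supNorm ρ₁ ρ₂ f := rfl
  have h₁ := radius_pos hI
  have : NormOneClass (AnnulusFun R I) := ⟨by
    refine le_antisymm ?_ ?_
    · refine (supNorm_single_le h₁ 0 (1 : R)).trans_eq ?_
      simp [annulusWeight]
    · refine le_trans (le_of_eq ?_) (le_supNorm hI (1 : AnnulusFun R I) 0)
      simp [annulusWeight, coeff_one]⟩
  have hc : IsUnit (single 1 1 : AnnulusFun R I) := by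
    refine IsUnit.of_mul_eq_one (single (-1) 1) ?_
    rw [single_mul_single, mul_one, add_neg_cancel, single_zero_one]
  obtain ⟨g, hg1, hna, hle, hzero, hmul⟩ := exists_ringSeminorm_le_norm hJ hc
  simp only [hnorm] at hle
  have hu01 : ‖u‖ ∈ Set.Ioo (0 : ℝ) 1 :=
    ⟨(norm_nonneg u).lt_of_ne' fun h => by simp [h] at huv', norm_lt_one_of_nilp hpow hu⟩
  obtain ⟨n, hn⟩ := exists_radius_eq_of_map_tSection_eq_zero p k hpow hR hI hna hg1 hle hmul
    hu huv huv' (hzero _ (Ideal.mem_sup_left (Ideal.mem_span_singleton_self _)))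
  obtain ⟨m, hm⟩ := exists_radius_eq_of_map_tSection_eq_zero p k hpow hR hI hna hg1 hle hmul
    (v := v ^ (q + 1)) hu' (by rw [← mul_pow, huv, one_pow])
    (by rw [hpow _ (by omega), hpow _ (by omega), ← mul_pow, huv', one_pow])
    (hzero _ (Ideal.mem_sup_right (Ideal.mem_span_singleton_self _)))
  rw [map_pow, hpow _ (by omega), hn] at hm
  exact pow_sub_one_ne_pow_succ_pow Fintype.one_lt_card
    (fun n => (norm_frobeniusEquiv_zpow_mem_Ioo p k hpow hR hu01 n).1)
    (fun n => (norm_frobeniusEquiv_zpow_mem_Ioo p k hpow hR hu01 n).2)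
    (strictMono_norm_frobeniusEquiv_zpow p k hpow hR hu01)
    (norm_frobeniusEquiv_zpow_pred p k hpow hR · u) m n hm

end Section

end AnnulusFun

end FarguesCurve

theorem mainTheorem6
    (p : ℕ) [Fact p.Prime]
    (k : Type*) [Field k] [Fintype k] [CharP k p]
    (R : Type*) [NormedCommRing R] [IsUltrametricDist R] [CompleteSpace R] [Algebra k R]
    (hR : IsPerfectoid p R)
    (Rplus : Subring R) (_hRplus : IsRingOfIntegralElements Rplus)
    (hpow : IsPowMul (norm : R → ℝ))
    (ϖ : R) (_hϖ : IsPseudoUniformizer ϖ) (_hϖ_norm : ‖ϖ‖ = (p : ℝ)⁻¹)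
    (_hϖ_mul : ∀ x : R, ‖ϖ * x‖ = ‖ϖ‖ * ‖x‖)
    (I : RadiusInterval) (r₁ r₂ : ℚ)
    (_hI : I.carrier = Set.Icc ((p : ℝ) ^ (r₁ : ℝ)) ((p : ℝ) ^ (r₂ : ℝ))) :
    (∃ (ε₁ ε₂ : R) (h₁ : IsPseudoUniformizer ε₁) (h₂ : IsPseudoUniformizer ε₂),
      Ideal.span {AnnulusFun.restrict I (AnnulusFun.tSection p k hpow hR ε₁ h₁.1)} ⊔
        Ideal.span {AnnulusFun.restrict I (AnnulusFun.tSection p k hpow hR ε₂ h₂.1)} = ⊤) ∧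
    (⋃ (ε : R) (hε : IsPseudoUniformizer ε),
      (PrimeSpectrum.basicOpen
        (AnnulusFun.restrict I (AnnulusFun.tSection p k hpow hR ε hε.1)) :
          Set (PrimeSpectrum (AnnulusFun R I)))) = Set.univ := by
  have hp : (0 : ℝ) < p := by exact_mod_cast (Fact.out : p.Prime).pos
  -- `‖1‖` is `0` or `1`, and it is not `0` because `‖ϖ‖ ≠ 0`.
  have : NormOneClass R := ⟨by
    have h := _hϖ_mul 1
    rw [mul_one, _hϖ_norm] at h
    exact (mul_eq_left₀ (inv_pos.mpr hp).ne').mp h.symm⟩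
  obtain ⟨v, hv⟩ := _hϖ.2.exists_right_inv
  have hv' : ‖ϖ‖ * ‖v‖ = 1 := by rw [← _hϖ_mul, hv, norm_one]
  have h₂ : IsPseudoUniformizer (ϖ ^ (Fintype.card k + 1)) := by
    refine ⟨?_, _hϖ.2.pow _⟩
    have h := Filter.Tendsto.pow _hϖ.1 (Fintype.card k + 1)
    rw [zero_pow (Nat.succ_ne_zero _)] at h
    exact h.congr fun n => pow_right_comm _ _ _
  have htop := AnnulusFun.span_tSection_sup_span_tSection_pow p k hpow hR _hI hv hv' _hϖ.1 h₂.1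
  refine ⟨⟨ϖ, _, _hϖ, h₂, htop⟩, Set.eq_univ_of_forall fun P => ?_⟩
  simp only [Set.mem_iUnion]
  by_contra! hcon
  have hmem (ε : R) (hε : IsPseudoUniformizer ε) :
      AnnulusFun.restrict I (AnnulusFun.tSection p k hpow hR ε hε.1) ∈ P.asIdeal := by
    by_contra h
    exact hcon ε hε h
  refine P.isPrime.ne_top (top_le_iff.mp (htop ▸ sup_le ?_ ?_)) <;>
    rw [Ideal.span_singleton_le_iff_mem]
  exacts [hmem _ _hϖ, hmem _ h₂]
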